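/- Let $r>2$ and let $(W,S)$ be a Coxeter system of type $A_r$, with $W=\langle s\in S\mid (ss')^{m(s,s')}=1\rangle$. Let $V$ be the complex vector space with basis $\{\alpha_s\}_{s\in S}$ and bilinear form $B(\alpha_s,\alpha_{s'})=-\cos\frac{\pi}{m(s,s')}$. Let $\rho_{ref}:W\to GL(V)$ be the standard reflection representation, $\rho_{ref}(s)v=v-2B(\alpha_s,v)\alpha_s$ for $s\in S$, let $\rho_{sign}:W\to\mathbb C^*$ be the sign representation, sending each $s\in S$ to $-1$, and let $\rho_{new}=\rho_{sign}\otimes\rho_{ref}:W\to GL(\mathbb C\otimes V)$. Then $\rho_{new}$ is irreducible, and it is not a reflection representation: the group $\rho_{new}(W)$ is not generated by the (pseudo-)reflections it contains, where a (pseudo-)reflection is a linear automorphism $g$ of finite order such that $g-1$ has rank one. Moreover the ring $\mathbb C[\rho_{new}]$ of $\rho_{new}(W)$-invariant polynomial functions on $\mathbb C\otimes V$ is not a polynomial ring, that is, it is not isomorphic as a $\mathbb C$-algebra to a polynomial ring $\mathbb C[x_i : i\in I]$ for any set $I$ of variables. -/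

import Mathlib

noncomputable section

namespace CoxeterRep

open scoped TensorProduct

/-- The standard bilinear form of a Coxeter matrix `M` on the space with basis `α_s`
(`α_s = Pi.single s 1`), determined by `B(α_s, α_t) = -cos(π / M s t)`. -/
def form {r : ℕ} (M : CoxeterMatrix (Fin r)) : LinearMap.BilinForm ℂ (Fin r → ℂ) :=
  Matrix.toBilin' (Matrix.of fun s t => ((-Real.cos (Real.pi / (M s t : ℝ)) : ℝ) : ℂ))

/-- The simple root `α_s`. -/
def root {r : ℕ} (s : Fin r) : Fin r → ℂ := Pi.single s 1

/-- The map `R_s : v ↦ v - 2 B(α_s, v) α_s`. -/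
def refl {r : ℕ} (M : CoxeterMatrix (Fin r)) (s : Fin r) : Module.End ℂ (Fin r → ℂ) :=
  LinearMap.id - ((2 : ℂ) • form M (root s)).smulRight (root s)

theorem refl_apply {r : ℕ} (M : CoxeterMatrix (Fin r)) (s : Fin r) (v : Fin r → ℂ) :
    refl M s v = v - (2 * form M (root s) v) • root s := by
  simp [refl]

theorem form_root {r : ℕ} (M : CoxeterMatrix (Fin r)) (s t : Fin r) :
    form M (root s) (root t) = ((-Real.cos (Real.pi / (M s t : ℝ)) : ℝ) : ℂ) := by
  simp [form, root, Matrix.toBilin'_single]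

theorem form_root_self {r : ℕ} (M : CoxeterMatrix (Fin r)) (s : Fin r) :
    form M (root s) (root s) = 1 := by
  simp [form_root]

theorem A_cases {r : ℕ} (s t : Fin r) :
    (s = t) ∨ CoxeterMatrix.A r s t = 2 ∨ CoxeterMatrix.A r s t = 3 := by
  by_cases h : s = t
  · exact Or.inl h
  · right
    simp only [CoxeterMatrix.A, Matrix.of_apply, if_neg h]
    split_ifs <;> simp

/-- The maps `R_s` satisfy the Coxeter relations of type `A_r`. -/
theorem refl_isLiftable (r : ℕ) :
    (CoxeterMatrix.A r).IsLiftable (refl (CoxeterMatrix.A r)) := by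
  intro s t
  have hs := form_root_self (CoxeterMatrix.A r) s
  have ht := form_root_self (CoxeterMatrix.A r) t
  have hst := form_root (CoxeterMatrix.A r) s t
  have hts := form_root (CoxeterMatrix.A r) t s
  rw [(CoxeterMatrix.A r).symmetric t s] at hts
  refine LinearMap.ext fun v => ?_
  rcases A_cases s t with rfl | h | h
  · rw [(CoxeterMatrix.A r).diagonal]
    simp only [pow_one, Module.End.mul_apply, Module.End.one_apply, refl_apply, map_sub, map_smul,
      smul_eq_mul, hs]
    module
  · rw [h] at hst hts ⊢
    simp only [Nat.cast_ofNat, Real.cos_pi_div_two, neg_zero, Complex.ofReal_zero] at hst hts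
    simp only [pow_succ, pow_zero, one_mul, Module.End.mul_apply, Module.End.one_apply, refl_apply,
      map_sub, map_smul, smul_eq_mul, hs, ht, hst, hts]
    module
  · rw [h] at hst hts ⊢
    have e : ((-Real.cos (Real.pi / ((3 : ℕ) : ℝ)) : ℝ) : ℂ) = -(1 / 2) := by
      rw [Nat.cast_ofNat, Real.cos_pi_div_three]; push_cast; ring
    rw [e] at hst hts
    simp only [pow_succ, pow_zero, one_mul, Module.End.mul_apply, Module.End.one_apply, refl_apply,
      map_sub, map_smul, smul_eq_mul, hs, ht, hst, hts]
    module

section Representations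

variable {r : ℕ} {W : Type*} [Group W]

/-- The standard reflection representation `s ↦ R_s` of a Coxeter group of type `A_r`. -/
def refRep (cs : CoxeterSystem (CoxeterMatrix.A r) W) : Representation ℂ W (Fin r → ℂ) :=
  cs.lift ⟨refl (CoxeterMatrix.A r), refl_isLiftable r⟩

/-- The sign representation, sending every simple generator to multiplication by `-1`. -/
def signRep (cs : CoxeterSystem (CoxeterMatrix.A r) W) : Representation ℂ W ℂ :=
  cs.lift ⟨fun _ => (-1 : Module.End ℂ ℂ), fun _ _ => by simp⟩

/-- The representation `ρ_new = ρ_sign ⊗ ρ_ref` on `ℂ ⊗ V`. -/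
def newRep (cs : CoxeterSystem (CoxeterMatrix.A r) W) :
    Representation ℂ W (ℂ ⊗[ℂ] (Fin r → ℂ)) :=
  (signRep cs).tprod (refRep cs)

end Representations

section General

variable {G V : Type*} [Group G] [AddCommGroup V] [Module ℂ V]

/-- A (pseudo-)reflection of a complex vector space: an automorphism of finite order whose fixed
subspace is a hyperplane, i.e. `g - 1` has rank one. -/
def IsReflection (g : LinearMap.GeneralLinearGroup ℂ V) : Prop :=
  IsOfFinOrder g ∧ Module.finrank ℂ (LinearMap.range ((g : V →ₗ[ℂ] V) - 1)) = 1

/-- The image `ψ(G)` is generated, as a group, by the reflections that it contains. -/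
def IsReflectionRep (ψ : Representation ℂ G V) : Prop :=
  Subgroup.closure {g | g ∈ ψ.asGroupHom.range ∧ IsReflection g} = ψ.asGroupHom.range

variable (V) in
/-- `ℂ[V]`, the algebra of polynomial functions on `V`: the subalgebra of all functions on `V`
generated by the linear forms. -/
def polyFun : Subalgebra ℂ (V → ℂ) :=
  Algebra.adjoin ℂ (Set.range fun φ : Module.Dual ℂ V => (φ : V → ℂ))

/-- `ℂ[ψ]`, the algebra of polynomial functions on `V` invariant under `ψ`. -/
def invariantRing (ψ : Representation ℂ G V) : Subalgebra ℂ (V → ℂ) where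
  carrier := {f | f ∈ polyFun V ∧ ∀ (g : G) (v : V), f (ψ g v) = f v}
  mul_mem' := fun ha hb => ⟨mul_mem ha.1 hb.1, fun g v => by simp [ha.2 g v, hb.2 g v]⟩
  add_mem' := fun ha hb => ⟨add_mem ha.1 hb.1, fun g v => by simp [ha.2 g v, hb.2 g v]⟩
  algebraMap_mem' := fun c => ⟨Subalgebra.algebraMap_mem _ c, fun _ _ => rfl⟩

end General

/-- A `ℂ`-algebra is a polynomial ring if it is isomorphic to `ℂ[x_i : i ∈ σ]` for some set `σ` of
variables. -/
def IsPolynomialRing (A : Type*) [CommRing A] [Algebra ℂ A] : Prop :=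
  ∃ σ : Type, Nonempty (A ≃ₐ[ℂ] MvPolynomial σ ℂ)

end CoxeterRep

end

noncomputable section

namespace CoxeterRep

open scoped TensorProduct

/-! ### Divisibility among polynomial functions and a factoriality obstruction -/

section PolynomialFunctions

variable {G V : Type*} [Group G] [AddCommGroup V] [Module ℂ V]

/-! In type `A_r` the root space is the sum-zero hyperplane of `ℂ^(r+1)`, and each `w` acts in the
twisted representation as `sign σ` times a permutation `σ` of the coordinates `y_i`
(`exists_perm_coord_newRep`).

Irreducibility: `ρ_new(s) + 1` has image in the line of `α_s`, so a non-zero subrepresentation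
contains a simple root, and then all of them, the Dynkin diagram being connected.

Reflections: for `r > 2` no `± σ - 1` of this kind has rank one, since a vanishing 2×2 minor is
contradicted (`finrank_range_newRep_sub_one_ne_one`). The image thus contains no reflection, yet it
is non-trivial.

Invariants: a polynomial ring is factorial. Let `f` be a product of linear forms and `h` the cube
sum, both transforming by the sign character and without common factor. Then `f² h² = (f h)²` holds
among invariants, so factoriality gives `f² = c a²`, `h² = c b²` with `a`, `b`, `c` invariant. Being
prime to `f` and a divisor of `f²`, `c` is constant. So `f` is a scalar multiple of `a`, hence
invariant: a contradiction (`not_isPolynomialRing_of_semiinvariants`). -/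

theorem dual_mem_polyFun (φ : Module.Dual ℂ V) : (φ : V → ℂ) ∈ polyFun V :=
  Algebra.subset_adjoin ⟨φ, rfl⟩

/-- A polynomial function is polynomial along every affine line. -/
theorem exists_polynomial_on_line {f : V → ℂ} (hf : f ∈ polyFun V) (a b : V) :
    ∃ p : Polynomial ℂ, ∀ t : ℂ, f (a + t • b) = p.eval t := by
  induction hf using Algebra.adjoin_induction with
  | mem x hx =>
    obtain ⟨φ, rfl⟩ := hx
    exact ⟨Polynomial.C (φ a) + Polynomial.X * Polynomial.C (φ b), fun t => by simp; ring⟩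
  | algebraMap c => exact ⟨Polynomial.C c, fun t => by simp⟩
  | add x y _ _ hx hy =>
    obtain ⟨p, hp⟩ := hx
    obtain ⟨q, hq⟩ := hy
    exact ⟨p + q, fun t => by simp [hp, hq]⟩
  | mul x y _ _ hx hy =>
    obtain ⟨p, hp⟩ := hx
    obtain ⟨q, hq⟩ := hy
    exact ⟨p * q, fun t => by simp [hp, hq]⟩

/-- On the line through a non-zero of `f` and a non-zero of `g` there is a common non-zero. -/
theorem exists_common_ne_zero {f g : V → ℂ} (hf : f ∈ polyFun V) (hg : g ∈ polyFun V) {a b : V}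
    (ha : f a ≠ 0) (hb : g b ≠ 0) :
    ∃ t : ℂ, f (a + t • (b - a)) ≠ 0 ∧ g (a + t • (b - a)) ≠ 0 := by
  obtain ⟨p, hp⟩ := exists_polynomial_on_line hf a (b - a)
  obtain ⟨q, hq⟩ := exists_polynomial_on_line hg a (b - a)
  have hp0 : p ≠ 0 := by
    rintro rfl
    exact ha (by simpa using hp 0)
  have hq0 : q ≠ 0 := by
    rintro rfl
    exact hb (by simpa using hq 1)
  by_contra! H
  refine mul_ne_zero hp0 hq0 (Polynomial.funext fun t => ?_)
  rw [Polynomial.eval_mul, ← hp, ← hq, Polynomial.eval_zero, mul_eq_zero, or_iff_not_imp_left]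
  exact H t

theorem polyFun_eq_zero_or_eq_zero {f g : V → ℂ} (hf : f ∈ polyFun V) (hg : g ∈ polyFun V)
    (h : f * g = 0) : f = 0 ∨ g = 0 := by
  by_contra! H
  obtain ⟨a, ha⟩ := Function.ne_iff.mp H.1
  obtain ⟨b, hb⟩ := Function.ne_iff.mp H.2
  obtain ⟨t, h1, h2⟩ := exists_common_ne_zero hf hg ha hb
  exact mul_ne_zero h1 h2 (congrFun h _)

theorem exists_prod_dual_ne_zero {ι : Type*} (s : Finset ι) (l : ι → Module.Dual ℂ V)
    (hl : ∀ i ∈ s, l i ≠ 0) : ∃ v, ∏ i ∈ s, l i v ≠ 0 := by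
  classical
  induction s using Finset.induction_on with
  | empty => exact ⟨0, by simp⟩
  | insert i s his ih =>
    obtain ⟨a, ha⟩ := ih fun j hj => hl j (Finset.mem_insert_of_mem hj)
    obtain ⟨b, hb⟩ := DFunLike.ne_iff.mp (hl i (Finset.mem_insert_self i s))
    have hs : ∏ i ∈ s, (l i : V → ℂ) ∈ polyFun V := prod_mem fun j _ => dual_mem_polyFun _
    obtain ⟨t, h1, h2⟩ := exists_common_ne_zero hs (dual_mem_polyFun (l i))
      (a := a) (b := b) (by simpa using ha) hb
    refine ⟨a + t • (b - a), ?_⟩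
    rw [Finset.prod_insert his]
    refine mul_ne_zero h2 ?_
    simpa using h1

/-- A nowhere vanishing polynomial function is constant. -/
theorem polyFun_const_of_forall_ne_zero {f : V → ℂ} (hf : f ∈ polyFun V) (h : ∀ v, f v ≠ 0)
    (a b : V) : f a = f b := by
  obtain ⟨p, hp⟩ := exists_polynomial_on_line hf a (b - a)
  have hdeg : p.degree = 0 := by
    by_contra hd
    obtain ⟨t, ht⟩ := Complex.isAlgClosed.exists_root p hd
    exact h _ ((hp t).trans ht)
  rw [Polynomial.eq_C_of_degree_eq_zero hdeg] at hp
  have h0 := hp 0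
  have h1 := hp 1
  simp only [zero_smul, add_zero, one_smul, add_sub_cancel, Polynomial.eval_C] at h0 h1
  rw [h0, h1]

/-- A polynomial function vanishing on the kernel of a non-zero linear form is divisible by it. -/
theorem exists_eq_mul_of_forall_ker {φ : Module.Dual ℂ V} (hφ : φ ≠ 0) {f : V → ℂ}
    (hf : f ∈ polyFun V) (h : ∀ v, φ v = 0 → f v = 0) :
    ∃ q ∈ polyFun V, f = (φ : V → ℂ) * q := by
  obtain ⟨u, hu⟩ : ∃ u, φ u = 1 := by
    obtain ⟨w, hw⟩ := DFunLike.ne_iff.mp hφ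
    exact ⟨(φ w)⁻¹ • w, by simpa using inv_mul_cancel₀ hw⟩
  -- Divided difference along `u`: `v - φ v • u` is the projection of `v` to `ker φ`, where `f`
  -- vanishes. Products obey a twisted Leibniz rule.
  have key : ∃ q ∈ polyFun V, ∀ v, f v - f (v - φ v • u) = φ v * q v := by
    clear h
    induction hf using Algebra.adjoin_induction with
    | mem x hx =>
      obtain ⟨η, rfl⟩ := hx
      exact ⟨_, Subalgebra.algebraMap_mem _ (η u), fun v => by simp⟩
    | algebraMap c => exact ⟨0, zero_mem _, fun v => by simp⟩
    | add x y _ _ hx hy =>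
      obtain ⟨p, hp, hp'⟩ := hx
      obtain ⟨q, hq, hq'⟩ := hy
      refine ⟨p + q, add_mem hp hq, fun v => ?_⟩
      simp only [Pi.add_apply]
      linear_combination hp' v + hq' v
    | mul x y hx0 hy0 hx hy =>
      obtain ⟨p, hp, hp'⟩ := hx
      obtain ⟨q, hq, hq'⟩ := hy
      refine ⟨p * y + x * q - (φ : V → ℂ) * (p * q), sub_mem (add_mem (mul_mem hp hy0)
        (mul_mem hx0 hq)) (mul_mem (dual_mem_polyFun φ) (mul_mem hp hq)), fun v => ?_⟩
      simp only [Pi.mul_apply, Pi.add_apply, Pi.sub_apply]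
      linear_combination (y (v - φ v • u)) * hp' v + (x v) * hq' v - φ v * p v * hq' v
  obtain ⟨q, hq, hq'⟩ := key
  refine ⟨q, hq, funext fun v => ?_⟩
  have := hq' v
  rwa [h (v - φ v • u) (by simp [hu]), sub_zero] at this

/-- A polynomial function without common factors with the linear forms `ℓ i` divides `e` as soon as
it divides `(∏ i, ℓ i) * e`. -/
theorem exists_mul_eq_of_mul_eq_prod_mul {ι : Type*} (s : Finset ι) (l : ι → Module.Dual ℂ V)
    (hl : ∀ i ∈ s, l i ≠ 0) {c e : V → ℂ} (hc : c ∈ polyFun V) (he : e ∈ polyFun V)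
    (hcl : ∀ i ∈ s, ∃ v, l i v = 0 ∧ c v ≠ 0)
    (h : ∃ d ∈ polyFun V, c * d = (∏ i ∈ s, (l i : V → ℂ)) * e) : ∃ d ∈ polyFun V, c * d = e := by
  classical
  induction s using Finset.induction_on with
  | empty => simpa using h
  | insert i s his ih =>
    refine ih (fun j hj => hl j (Finset.mem_insert_of_mem hj))
      (fun j hj => hcl j (Finset.mem_insert_of_mem hj)) ?_
    obtain ⟨d, hd, hcd⟩ := h
    rw [Finset.prod_insert his] at hcd
    obtain ⟨v, hv, hcv⟩ := hcl i (Finset.mem_insert_self i s)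
    have hli := hl i (Finset.mem_insert_self i s)
    obtain ⟨q, hq, rfl⟩ : ∃ q ∈ polyFun V, d = (l i : V → ℂ) * q := by
      -- If `d` were non-zero at some `u` in `ker (l i)`, the line from `v` to `u`, which stays in
      -- that kernel, would contain a common non-zero of `c` and `d`, although `c * d` vanishes
      -- there.
      refine exists_eq_mul_of_forall_ker hli hd fun u hu => ?_
      by_contra hdu
      obtain ⟨t, h1, h2⟩ := exists_common_ne_zero hc hd hcv hdu
      refine mul_ne_zero h1 h2 ?_
      have := congrFun hcd (v + t • (u - v))
      simpa [hv, hu] using this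
    refine ⟨q, hq, ?_⟩
    have hz : (l i : V → ℂ) * (c * q - (∏ i ∈ s, (l i : V → ℂ)) * e) = 0 := by
      linear_combination hcd
    rcases polyFun_eq_zero_or_eq_zero (dual_mem_polyFun _) (sub_mem (mul_mem hc hq)
      (mul_mem (prod_mem fun j _ => dual_mem_polyFun _) he)) hz with h0 | h0
    · exact absurd (DFunLike.coe_injective h0) hli
    · exact sub_eq_zero.mp h0

/-- In a factorial ring, two elements whose product is a square have the same square class. -/
theorem exists_eq_mul_sq_of_mul_eq_sq {R : Type*} [CommRing R] [IsDomain R]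
    [UniqueFactorizationMonoid R] {x y z : R} (hx : x ≠ 0) (h : x * y = z ^ 2) :
    ∃ c a b, x = c * a ^ 2 ∧ y = c * b ^ 2 := by
  obtain ⟨a, b, d, hab, rfl, rfl⟩ := UniqueFactorizationMonoid.exists_reduced_factors x hx z
  have hd : d ≠ 0 := left_ne_zero_of_mul hx
  have ha : a ≠ 0 := right_ne_zero_of_mul hx
  have h1 : a * y = d * b ^ 2 := mul_left_cancel₀ hd (by linear_combination h)
  -- `a` divides `d * b ^ 2` and is prime to `b`.
  obtain ⟨c, rfl⟩ : a ∣ d := (hab.pow_right (n := 2)).dvd_of_dvd_mul_right ⟨y, h1.symm⟩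
  exact ⟨c, a, b, by ring, mul_left_cancel₀ ha (by linear_combination h1)⟩

theorem IsPolynomialRing.uniqueFactorizationMonoid {A : Type*} [CommRing A] [Algebra ℂ A]
    (h : IsPolynomialRing A) : UniqueFactorizationMonoid A := by
  obtain ⟨σ, ⟨e⟩⟩ := h
  exact e.symm.toMulEquiv.uniqueFactorizationMonoid inferInstance

/-- If a product `f` of linear forms and a polynomial function `h` prime to it are semi-invariants
of the same non-trivial quadratic character, the ring of invariants is not a polynomial ring. -/
theorem not_isPolynomialRing_of_semiinvariants (ψ : Representation ℂ G V) (χ : G → ℂ)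
    (hχ : ∀ g, χ g ^ 2 = 1) {g₀ : G} (hg₀ : χ g₀ ≠ 1) {ι : Type*} (s : Finset ι)
    (l : ι → Module.Dual ℂ V) (hl0 : ∀ i ∈ s, l i ≠ 0)
    (hl : ∀ g v, ∏ i ∈ s, l i (ψ g v) = χ g * ∏ i ∈ s, l i v)
    {h : V → ℂ} (hh : h ∈ polyFun V) (hhχ : ∀ g v, h (ψ g v) = χ g * h v)
    (hlh : ∀ i ∈ s, ∃ v, l i v = 0 ∧ h v ≠ 0) :
    ¬ IsPolynomialRing (invariantRing ψ) := by
  intro hpoly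
  have := hpoly.uniqueFactorizationMonoid
  have hdom : IsDomain (invariantRing ψ) := by
    have : NoZeroDivisors (invariantRing ψ) := ⟨fun {a b} hab =>
      (polyFun_eq_zero_or_eq_zero a.2.1 b.2.1 (congrArg Subtype.val hab)).imp
        (fun h0 => Subtype.ext h0) (fun h0 => Subtype.ext h0)⟩
    exact NoZeroDivisors.to_isDomain _
  set f : V → ℂ := ∏ i ∈ s, (l i : V → ℂ) with hf
  have hfv : ∀ v, f v = ∏ i ∈ s, l i v := fun v => by simp [hf]
  have hfp : f ∈ polyFun V := prod_mem fun j _ => dual_mem_polyFun _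
  have hfχ : ∀ g v, f (ψ g v) = χ g * f v := fun g v => by rw [hfv, hfv, hl]
  obtain ⟨v₀, hv₀⟩ := exists_prod_dual_ne_zero s l hl0
  let x : invariantRing ψ := ⟨f ^ 2, pow_mem hfp 2, fun g v => by
    simp [hfχ, mul_pow, hχ]⟩
  let y : invariantRing ψ := ⟨h ^ 2, pow_mem hh 2, fun g v => by
    simp [hhχ, mul_pow, hχ]⟩
  let z : invariantRing ψ := ⟨f * h, mul_mem hfp hh, fun g v => by
    simp only [Pi.mul_apply, hfχ, hhχ]
    linear_combination f v * h v * hχ g⟩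
  have hxyz : x * y = z ^ 2 := Subtype.ext (by simp [x, y, z, mul_pow])
  have hx : x ≠ 0 := by
    intro hx
    have := congrFun (congrArg Subtype.val hx) v₀
    refine pow_ne_zero 2 hv₀ ?_
    rw [← hfv]
    exact this
  obtain ⟨c, a, b, hxc, hyc⟩ := exists_eq_mul_sq_of_mul_eq_sq hx hxyz
  have hxc' : f ^ 2 = (c : V → ℂ) * (a : V → ℂ) ^ 2 := congrArg Subtype.val hxc
  have hyc' : h ^ 2 = (c : V → ℂ) * (b : V → ℂ) ^ 2 := congrArg Subtype.val hyc
  have hcl : ∀ i ∈ s, ∃ v, l i v = 0 ∧ (c : V → ℂ) v ≠ 0 := by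
    intro i hi
    obtain ⟨v, h1, h2⟩ := hlh i hi
    refine ⟨v, h1, fun h3 => h2 ?_⟩
    have := congrFun hyc' v
    simpa [h3] using this
  have hc := c.2.1
  -- `c` divides `f ^ 2 = f * (f * 1)`; the two copies of `f` are cancelled one after the other.
  have hdvd : ∃ d ∈ polyFun V, (c : V → ℂ) * d = 1 :=
    exists_mul_eq_of_mul_eq_prod_mul s l hl0 hc (one_mem _) hcl
      (exists_mul_eq_of_mul_eq_prod_mul s l hl0 hc (mul_mem hfp (one_mem _)) hcl
        ⟨(a : V → ℂ) ^ 2, pow_mem a.2.1 2, by rw [← hxc', mul_one, sq]⟩)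
  obtain ⟨d, -, hcd⟩ := hdvd
  have hc0 : ∀ v, (c : V → ℂ) v ≠ 0 := fun v hv => by
    have := congrFun hcd v
    simp [hv] at this
  -- A square root of the constant `c` splits `f² - c a²` into `(f - m a)(f + m a)`.
  obtain ⟨m, hm⟩ := IsAlgClosed.exists_pow_nat_eq ((c : V → ℂ) v₀) (n := 2) two_pos
  have hcm : (c : V → ℂ) = algebraMap ℂ (V → ℂ) m ^ 2 := funext fun v => by
    simpa [hm] using polyFun_const_of_forall_ne_zero hc hc0 v v₀
  have hsub : ∀ k : ℂ, (f : V → ℂ) ≠ algebraMap ℂ (V → ℂ) k * a := by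
    intro k hk
    have hinv : f (ψ g₀ v₀) = f v₀ := by
      rw [hk]
      simp [a.2.2 g₀ v₀]
    rw [hfχ] at hinv
    rw [← hfv] at hv₀
    exact hg₀ (mul_right_cancel₀ hv₀ (by rw [hinv, one_mul]))
  have hma : ∀ k : ℂ, algebraMap ℂ (V → ℂ) k * (a : V → ℂ) ∈ polyFun V := fun k =>
    mul_mem (Subalgebra.algebraMap_mem _ k) a.2.1
  rcases polyFun_eq_zero_or_eq_zero (sub_mem hfp (hma m)) (sub_mem hfp (hma (-m)))
    (by rw [map_neg]; linear_combination hxc' + (a : V → ℂ) ^ 2 * hcm) with h0 | h0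
  · exact hsub m (sub_eq_zero.mp h0)
  · exact hsub (-m) (sub_eq_zero.mp h0)

end PolynomialFunctions

/-! ### The root space as the sum-zero hyperplane -/

section Coordinates

variable {r : ℕ}

/-- The embedding `α_s ↦ e_s - e_{s+1}` of the root space into the permutation module. -/
def permCoord (r : ℕ) : (Fin r → ℂ) →ₗ[ℂ] (Fin (r + 1) → ℂ) where
  toFun v i := Fin.snoc (α := fun _ => ℂ) v 0 i - Fin.cons (α := fun _ => ℂ) 0 v i
  map_add' v w := by
    ext i
    have h1 : Fin.snoc (α := fun _ => ℂ) (v + w) 0 i =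
        Fin.snoc (α := fun _ => ℂ) v 0 i + Fin.snoc (α := fun _ => ℂ) w 0 i := by
      cases i using Fin.lastCases <;> simp
    have h2 : Fin.cons (α := fun _ => ℂ) 0 (v + w) i =
        Fin.cons (α := fun _ => ℂ) 0 v i + Fin.cons (α := fun _ => ℂ) 0 w i := by
      cases i using Fin.cases <;> simp
    simp only [h1, h2, Pi.add_apply]
    ring
  map_smul' c v := by
    ext i
    have h1 : Fin.snoc (α := fun _ => ℂ) (c • v) 0 i = c * Fin.snoc (α := fun _ => ℂ) v 0 i := by
      cases i using Fin.lastCases <;> simp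
    have h2 : Fin.cons (α := fun _ => ℂ) 0 (c • v) i = c * Fin.cons (α := fun _ => ℂ) 0 v i := by
      cases i using Fin.cases <;> simp
    simp only [h1, h2, Pi.smul_apply, smul_eq_mul, RingHom.id_apply]
    ring

theorem permCoord_apply (v : Fin r → ℂ) (i : Fin (r + 1)) :
    permCoord r v i = Fin.snoc (α := fun _ => ℂ) v 0 i - Fin.cons (α := fun _ => ℂ) 0 v i :=
  rfl

theorem permCoord_root (s : Fin r) :
    permCoord r (root s) = Pi.single s.castSucc 1 - Pi.single s.succ 1 := by
  ext i
  have h1 : Fin.snoc (α := fun _ => ℂ) (root s) 0 i = (Pi.single s.castSucc 1 : _ → ℂ) i := by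
    cases i using Fin.lastCases <;> simp [root, Pi.single_apply]
  have h2 : Fin.cons (α := fun _ => ℂ) 0 (root s) i = (Pi.single s.succ 1 : _ → ℂ) i := by
    cases i using Fin.cases <;> simp [root, Pi.single_apply]
  rw [permCoord_apply, h1, h2, Pi.sub_apply]

theorem permCoord_injective : Function.Injective (permCoord r) := by
  rw [injective_iff_map_eq_zero]
  intro v hv
  have h : ∀ i, Fin.snoc (α := fun _ => ℂ) v 0 i = Fin.cons (α := fun _ => ℂ) 0 v i := fun i =>
    sub_eq_zero.mp (congrFun hv i)
  have h0 : ∀ i, Fin.snoc (α := fun _ => ℂ) v 0 i = 0 := by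
    intro i
    induction i using Fin.induction with
    | zero => simp [h]
    | succ j ih =>
      rw [h, Fin.cons_succ]
      simpa using ih
  ext j
  simpa using h0 j.castSucc

theorem sum_permCoord (v : Fin r → ℂ) : ∑ i, permCoord r v i = 0 := by
  simp only [permCoord_apply, Finset.sum_sub_distrib]
  rw [Fin.sum_univ_castSucc, Fin.sum_univ_succ (f := fun i => Fin.cons (α := fun _ => ℂ) 0 v i)]
  simp

theorem exists_permCoord_eq {y : Fin (r + 1) → ℂ} (hy : ∑ i, y i = 0) :
    ∃ v, permCoord r v = y := by
  -- Partial sums invert the difference map; the final `0` supplied by `Fin.snoc` is the total sum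
  -- of `y`.
  refine ⟨fun j => ∑ k ∈ Finset.Iic j.castSucc, y k, funext fun i => ?_⟩
  have h1 : ∀ i, Fin.snoc (α := fun _ => ℂ) (fun j : Fin r => ∑ k ∈ Finset.Iic j.castSucc, y k) 0 i
      = ∑ k ∈ Finset.Iic i, y k := by
    intro i
    cases i using Fin.lastCases with
    | last =>
      rw [Fin.snoc_last, ← hy]
      refine Finset.sum_congr (Finset.ext fun k => ?_) fun _ _ => rfl
      simp [Fin.le_last]
    | cast j => simp
  have h2 : ∀ i, Fin.cons (α := fun _ => ℂ) 0 (fun j : Fin r => ∑ k ∈ Finset.Iic j.castSucc, y k) i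
      = ∑ k ∈ Finset.Iio i, y k := by
    intro i
    cases i using Fin.cases with
    | zero =>
      rw [Fin.cons_zero, Finset.sum_eq_zero]
      intro k hk
      simp at hk
    | succ j =>
      rw [Fin.cons_succ]
      refine Finset.sum_congr (Finset.ext fun k => ?_) fun _ _ => rfl
      simp [Fin.lt_def, Fin.le_def]
  rw [permCoord_apply, h1, h2, ← Finset.Iio_insert, Finset.sum_insert (by simp)]
  ring

/-- `2B` is the standard dot product restricted to the hyperplane, where `α_s` becomes `e_s -
e_{s+1}`; it suffices to compare both sides on simple roots. -/
theorem two_mul_form_root (s : Fin r) (v : Fin r → ℂ) :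
    2 * form (CoxeterMatrix.A r) (root s) v = permCoord r v s.castSucc - permCoord r v s.succ := by
  have h : (2 : ℂ) • form (CoxeterMatrix.A r) (root s) =
      (LinearMap.proj (R := ℂ) (φ := fun _ => ℂ) s.castSucc - LinearMap.proj s.succ) ∘ₗ permCoord r := by
    refine LinearMap.pi_ext' fun t => LinearMap.ext_ring ?_
    have hst := form_root (CoxeterMatrix.A r) s t
    have ht := permCoord_root t
    rw [root] at ht
    simp only [LinearMap.comp_apply, LinearMap.smul_apply, LinearMap.sub_apply,
      LinearMap.proj_apply, LinearMap.coe_single, ht, Pi.sub_apply, Pi.single_apply,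
      Fin.castSucc_inj, Fin.succ_inj, smul_eq_mul]
    rw [root, root] at hst
    rw [root, hst]
    have hA : (CoxeterMatrix.A r) s t = if s = t then 1
      else (if (t : ℕ) + 1 = s ∨ (s : ℕ) + 1 = t then 3 else 2) := rfl
    have e1 : s.castSucc = t.succ ↔ (t : ℕ) + 1 = s := by simp [Fin.ext_iff, eq_comm]
    have e2 : s.succ = t.castSucc ↔ (s : ℕ) + 1 = t := by simp [Fin.ext_iff]
    simp only [hA, e1, e2]
    by_cases h1 : s = t
    · subst h1
      norm_num
    · by_cases h2 : (t : ℕ) + 1 = s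
      · have h3 : ¬ (s : ℕ) + 1 = t := by omega
        simp [h1, h2, h3]
      · by_cases h3 : (s : ℕ) + 1 = t
        · simp [h1, h2, h3]
        · simp [h1, h2, h3]
  simpa using LinearMap.congr_fun h v

theorem permCoord_refl (s : Fin r) (v : Fin r → ℂ) (i : Fin (r + 1)) :
    permCoord r (refl (CoxeterMatrix.A r) s v) i =
      permCoord r v (Equiv.swap s.castSucc s.succ i) := by
  have hne : s.castSucc ≠ s.succ := Fin.castSucc_lt_succ.ne
  rw [refl_apply, two_mul_form_root, map_sub, map_smul, permCoord_root]
  by_cases h1 : i = s.castSucc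
  · subst h1
    simp [hne]
  · by_cases h2 : i = s.succ
    · subst h2
      simp [hne.symm]
    · simp [Equiv.swap_apply_of_ne_of_ne h1 h2, h1, h2]

end Coordinates

/-! ### The twisted action in coordinates -/

section NewRep

variable {r : ℕ} {W : Type*} [Group W] (cs : CoxeterSystem (CoxeterMatrix.A r) W)

/-- The coordinates of `ℂ ⊗ V` in the permutation module. -/
def coord (r : ℕ) : (ℂ ⊗[ℂ] (Fin r → ℂ)) →ₗ[ℂ] (Fin (r + 1) → ℂ) :=
  permCoord r ∘ₗ (TensorProduct.lid ℂ (Fin r → ℂ)).toLinearMap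

theorem coord_injective : Function.Injective (coord r) :=
  permCoord_injective.comp (TensorProduct.lid ℂ (Fin r → ℂ)).injective

theorem sum_coord (x : ℂ ⊗[ℂ] (Fin r → ℂ)) : ∑ i, coord r x i = 0 :=
  sum_permCoord _

theorem exists_coord_eq {y : Fin (r + 1) → ℂ} (hy : ∑ i, y i = 0) : ∃ x, coord r x = y := by
  obtain ⟨v, rfl⟩ := exists_permCoord_eq hy
  exact ⟨1 ⊗ₜ v, by simp [coord]⟩

theorem signRep_simple (s : Fin r) : signRep cs (cs.simple s) = -1 :=
  cs.lift_apply_simple _ s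

theorem refRep_simple (s : Fin r) : refRep cs (cs.simple s) = refl (CoxeterMatrix.A r) s :=
  cs.lift_apply_simple _ s

theorem coord_newRep_simple (s : Fin r) (x : ℂ ⊗[ℂ] (Fin r → ℂ)) (i : Fin (r + 1)) :
    coord r (newRep cs (cs.simple s) x) i = - coord r x (Equiv.swap s.castSucc s.succ i) := by
  induction x using TensorProduct.induction_on with
  | zero => simp
  | tmul a v =>
    simp [newRep, coord, signRep_simple, refRep_simple, permCoord_refl]
  | add x y hx hy => simp only [map_add, Pi.add_apply, hx, hy, neg_add]

/-- Every element of `W` acts on coordinates by a permutation, twisted by its sign. -/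
theorem exists_perm_coord_newRep (w : W) : ∃ σ : Equiv.Perm (Fin (r + 1)),
    signRep cs w 1 = ((Equiv.Perm.sign σ : ℤ) : ℂ) ∧
      ∀ x i, coord r (newRep cs w x) i = ((Equiv.Perm.sign σ : ℤ) : ℂ) * coord r x (σ i) := by
  induction w using cs.simple_induction with
  | one => exact ⟨1, by simp, by simp⟩
  | simple s =>
    have hs : Equiv.Perm.sign (Equiv.swap s.castSucc s.succ) = -1 :=
      Equiv.Perm.sign_swap Fin.castSucc_lt_succ.ne
    exact ⟨Equiv.swap s.castSucc s.succ, by simp [signRep_simple, hs], fun x i => by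
      rw [coord_newRep_simple, hs]; simp⟩
  | mul v w hv hw =>
    obtain ⟨σ, h1, h2⟩ := hv
    obtain ⟨τ, h3, h4⟩ := hw
    -- The order is reversed because permutations act on coordinates by precomposition.
    refine ⟨τ * σ, ?_, fun x i => ?_⟩
    · rw [map_mul, Module.End.mul_apply, h3, ← mul_one ((_ : ℤ) : ℂ), ← smul_eq_mul, map_smul, h1]
      simp
    · rw [map_mul, Module.End.mul_apply, h2, h4]
      simp
      ring

end NewRep

/-! ### Irreducibility -/

section Irreducible

variable {r : ℕ} {W : Type*} [Group W] (cs : CoxeterSystem (CoxeterMatrix.A r) W)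

theorem coord_one_tmul_root (s : Fin r) :
    coord r (1 ⊗ₜ root s) = Pi.single s.castSucc 1 - Pi.single s.succ 1 := by
  simp [coord, permCoord_root]

theorem newRep_simple_add_self (s : Fin r) (x : ℂ ⊗[ℂ] (Fin r → ℂ)) :
    newRep cs (cs.simple s) x + x =
      (coord r x s.castSucc - coord r x s.succ) • ((1 : ℂ) ⊗ₜ[ℂ] root s) := by
  refine coord_injective (funext fun i => ?_)
  have hne : s.castSucc ≠ s.succ := Fin.castSucc_lt_succ.ne
  rw [map_add, Pi.add_apply, coord_newRep_simple, map_smul, coord_one_tmul_root]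
  by_cases h1 : i = s.castSucc
  · subst h1
    simp [hne]
    ring
  · by_cases h2 : i = s.succ
    · subst h2
      simp [hne.symm]
      ring
    · simp [Equiv.swap_apply_of_ne_of_ne h1 h2, h1, h2]

/-- Otherwise all coordinates are equal, and their sum being zero makes them vanish. -/
theorem exists_coord_ne {x : ℂ ⊗[ℂ] (Fin r → ℂ)} (hx : x ≠ 0) :
    ∃ s : Fin r, coord r x s.castSucc ≠ coord r x s.succ := by
  by_contra! h
  have hconst : ∀ i, coord r x i = coord r x 0 := by
    intro i
    induction i using Fin.induction with
    | zero => rfl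
    | succ j ih => rw [← h, ih]
  have hsum := sum_coord x
  simp only [hconst, Finset.sum_const, Finset.card_univ, Fintype.card_fin, nsmul_eq_mul,
    mul_eq_zero] at hsum
  have h0 := hsum.resolve_left (by exact_mod_cast Nat.succ_ne_zero r)
  exact hx (coord_injective (funext fun i => by rw [hconst, h0]; simp))

theorem newRep_isIrreducible (hr : 0 < r) : (newRep cs).IsIrreducible := by
  have hne : (⊥ : Subrepresentation (newRep cs)) ≠ ⊤ := by
    intro h
    have hmem : (1 : ℂ) ⊗ₜ[ℂ] root (⟨0, hr⟩ : Fin r) ∈ (⊥ : Subrepresentation (newRep cs)) := by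
      rw [h]
      exact Submodule.mem_top
    have h0 : (1 : ℂ) ⊗ₜ[ℂ] root (⟨0, hr⟩ : Fin r) = 0 := (Submodule.mem_bot ℂ).mp hmem
    have h1 := congrFun (coord_one_tmul_root (⟨0, hr⟩ : Fin r)) (Fin.castSucc ⟨0, hr⟩)
    rw [h0] at h1
    simp at h1
  have : Nontrivial (Subrepresentation (newRep cs)) := ⟨_, _, hne⟩
  refine ⟨fun U => or_iff_not_imp_left.mpr fun hU => ?_⟩
  obtain ⟨x, hxU, hx⟩ : ∃ x ∈ U.toSubmodule, x ≠ 0 := by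
    by_contra! h
    exact hU (Subrepresentation.toSubmodule_injective ((Submodule.eq_bot_iff _).mpr h))
  have key : ∀ x ∈ U.toSubmodule, ∀ s : Fin r, coord r x s.castSucc ≠ coord r x s.succ →
      (1 : ℂ) ⊗ₜ[ℂ] root s ∈ U.toSubmodule := by
    intro x hx s hs
    have h := U.toSubmodule.add_mem (U.apply_mem_toSubmodule (cs.simple s) hx) hx
    rw [newRep_simple_add_self] at h
    exact (Submodule.smul_mem_iff _ (sub_ne_zero.mpr hs)).mp h
  obtain ⟨s, hs⟩ := exists_coord_ne hx
  have hsU := key x hxU s hs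
  -- For neighbours in the Dynkin diagram, `α_s` has different coordinates at the two positions
  -- exchanged by `t`, so `key` applies to it.
  have hadj : ∀ s t : Fin r, (s : ℕ) + 1 = t ∨ (t : ℕ) + 1 = s →
      (1 : ℂ) ⊗ₜ[ℂ] root s ∈ U.toSubmodule → (1 : ℂ) ⊗ₜ[ℂ] root t ∈ U.toSubmodule := by
    intro s t hst h
    refine key _ h t ?_
    rw [coord_one_tmul_root]
    simp only [Pi.sub_apply, Pi.single_apply, Fin.ext_iff, Fin.val_castSucc, Fin.val_succ]
    rcases hst with hst | hst
    · have h1 : ¬ (t : ℕ) = s := by omega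
      have h2 : ¬ (t : ℕ) + 1 = s := by omega
      simp [h1, h2, hst]
    · have h1 : ¬ (t : ℕ) = s := by omega
      have h2 : ¬ (t : ℕ) = s + 1 := by omega
      simp [h1, h2, hst]
  have hup : ∀ (k : ℕ) (h : (s : ℕ) + k < r),
      (1 : ℂ) ⊗ₜ[ℂ] root (⟨s + k, h⟩ : Fin r) ∈ U.toSubmodule := by
    intro k
    induction k with
    | zero => exact fun _ => hsU
    | succ k ih => exact fun h => hadj ⟨s + k, by omega⟩ _ (Or.inl rfl) (ih _)
  have hdown : ∀ (k : ℕ) (h : (s : ℕ) - k < r),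
      (1 : ℂ) ⊗ₜ[ℂ] root (⟨s - k, h⟩ : Fin r) ∈ U.toSubmodule := by
    intro k
    induction k with
    | zero => exact fun _ => hsU
    | succ k ih =>
      intro h
      -- Subtraction is truncated: once `s ≤ k` the index stays at `0`.
      by_cases hk : (s : ℕ) ≤ k
      · have := ih (by omega)
        simp only [show (s : ℕ) - (k + 1) = s - k by omega]
        exact this
      · exact hadj ⟨s - k, by omega⟩ _ (Or.inr (by simp only; omega)) (ih _)
  have hall : ∀ t : Fin r, (1 : ℂ) ⊗ₜ[ℂ] root t ∈ U.toSubmodule := by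
    intro t
    rcases le_total (s : ℕ) t with h | h
    · have := hup (t - s) (by omega)
      simpa only [show (s : ℕ) + (t - s) = t by omega] using this
    · have := hdown (s - t) (by omega)
      simpa only [show (s : ℕ) - (s - t) = t by omega] using this
  refine Subrepresentation.toSubmodule_injective ((Submodule.eq_top_iff').mpr fun y => ?_)
  have hy : y = ∑ t, (TensorProduct.lid ℂ _ y) t • ((1 : ℂ) ⊗ₜ[ℂ] root t) := by
    apply (TensorProduct.lid ℂ (Fin r → ℂ)).injective
    ext j
    simp [root, Pi.single_apply]
  rw [hy]
  exact Submodule.sum_mem _ fun t _ => Submodule.smul_mem _ _ (hall t)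

end Irreducible

/-! ### Absence of reflections -/

section Reflections

variable {r : ℕ} {W : Type*} [Group W] (cs : CoxeterSystem (CoxeterMatrix.A r) W)

/-- The 2×2 minors of a rank-one map vanish. -/
theorem mul_eq_mul_of_finrank_range_eq_one {V : Type*} [AddCommGroup V] [Module ℂ V]
    {T : V →ₗ[ℂ] V} (hT : Module.finrank ℂ (LinearMap.range T) = 1) (a b : Module.Dual ℂ V)
    (v w : V) : a (T v) * b (T w) = a (T w) * b (T v) := by
  obtain ⟨u, -, hu⟩ := finrank_eq_one_iff'.mp hT
  obtain ⟨c, hc⟩ := hu ⟨T v, v, rfl⟩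
  obtain ⟨d, hd⟩ := hu ⟨T w, w, rfl⟩
  have hc' : T v = c • (u : V) := (congrArg Subtype.val hc).symm
  have hd' : T w = d • (u : V) := (congrArg Subtype.val hd).symm
  simp only [hc', hd', map_smul, smul_eq_mul]
  ring

theorem exists_notMem_of_card_le {n k : ℕ} (s : Finset (Fin n)) (hs : s.card ≤ k) (hk : k < n) :
    ∃ m, m ∉ s := by
  by_contra! h
  have := Finset.card_le_card (fun i _ => h i : (Finset.univ : Finset (Fin n)) ⊆ s)
  rw [Finset.card_univ, Fintype.card_fin] at this
  omega

/-- An even non-trivial permutation moves some point outside of `{i, σ i}`. -/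
theorem exists_apply_ne_of_sign_eq_one {n : ℕ} {σ : Equiv.Perm (Fin n)}
    (hσ : Equiv.Perm.sign σ = 1) (h1 : σ ≠ 1) :
    ∃ i j, σ i ≠ i ∧ σ j ≠ j ∧ j ≠ i ∧ j ≠ σ i := by
  obtain ⟨i, hi⟩ : ∃ i, σ i ≠ i := by
    by_contra! h
    exact h1 (Equiv.ext h)
  by_contra! h
  have hsupp : σ.support ⊆ {i, σ i} := by
    intro j hj
    rw [Equiv.Perm.mem_support] at hj
    by_cases hji : j = i
    · simp [hji]
    · simp [h i j hi hj hji]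
  have hcard : σ.support.card = 2 := le_antisymm
    ((Finset.card_le_card hsupp).trans Finset.card_le_two)
    (Equiv.Perm.two_le_card_support_of_ne_one h1)
  have := (Equiv.Perm.card_support_eq_two.mp hcard).sign_eq
  rw [hσ] at this
  exact absurd this (by decide)

theorem exists_disjoint_of_sign_eq_neg_one_four (σ : Equiv.Perm (Fin 4))
    (hσ : Equiv.Perm.sign σ = -1) :
    ∃ k l m, l ≠ k ∧ l ≠ σ k ∧ m ≠ k ∧ m ≠ σ k ∧ m ≠ l ∧ m ≠ σ l := by
  revert σ
  decide

/-- With at least five points, counting suffices for any permutation. With four points oddness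
matters: a double transposition has no such triple. -/
theorem exists_disjoint_of_sign_eq_neg_one (hr : 2 < r) {σ : Equiv.Perm (Fin (r + 1))}
    (hσ : Equiv.Perm.sign σ = -1) :
    ∃ k l m, l ≠ k ∧ l ≠ σ k ∧ m ≠ k ∧ m ≠ σ k ∧ m ≠ l ∧ m ≠ σ l := by
  obtain rfl | hr' : r = 3 ∨ 3 < r := by omega
  · exact exists_disjoint_of_sign_eq_neg_one_four σ hσ
  · obtain ⟨l, hl⟩ := exists_notMem_of_card_le {0, σ 0} Finset.card_le_two (by omega)
    obtain ⟨m, hm⟩ := exists_notMem_of_card_le {0, σ 0, l, σ l} Finset.card_le_four (by omega)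
    simp only [Finset.mem_insert, Finset.mem_singleton, not_or] at hl hm
    exact ⟨0, l, m, hl.1, hl.2, hm.1, hm.2.1, hm.2.2.1, hm.2.2.2⟩

theorem finrank_range_newRep_sub_one_ne_one (hr : 2 < r) (w : W) :
    Module.finrank ℂ (LinearMap.range (newRep cs w - 1)) ≠ 1 := by
  intro hT
  obtain ⟨σ, -, hσ⟩ := exists_perm_coord_newRep cs w
  have hD : ∀ x i, coord r ((newRep cs w - 1) x) i =
      ((Equiv.Perm.sign σ : ℤ) : ℂ) * coord r x (σ i) - coord r x i := fun x i => by
    simp [hσ]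
  have hminor : ∀ (i j : Fin (r + 1)) x y, coord r ((newRep cs w - 1) x) i *
      coord r ((newRep cs w - 1) y) j = coord r ((newRep cs w - 1) y) i *
      coord r ((newRep cs w - 1) x) j := fun i j x y =>
    mul_eq_mul_of_finrank_range_eq_one hT (LinearMap.proj i ∘ₗ coord r)
      (LinearMap.proj j ∘ₗ coord r) x y
  simp only [hD] at hminor
  rcases Int.units_eq_one_or (Equiv.Perm.sign σ) with hs | hs
  · by_cases h1 : σ = 1
    · have h0 : newRep cs w - 1 = 0 := LinearMap.ext fun x => coord_injective (funext fun i => by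
        simp [hσ, h1])
      rw [h0, LinearMap.range_zero, finrank_bot] at hT
      exact zero_ne_one hT
    · obtain ⟨i, j, hi, hj, hji, hjs⟩ := exists_apply_ne_of_sign_eq_one hs h1
      -- The vectors `(r+1) e_k - (1, …, 1)` have sum zero, and their constant part is killed by `σ
      -- - 1`. The minor in rows `i`, `j` is then triangular with diagonal entries `-(r+1)`.
      have hex : ∀ k : Fin (r + 1), ∃ x, ∀ i,
          coord r x i = (if i = k then (r + 1 : ℂ) else 0) - 1 := by
        intro k
        obtain ⟨x, hx⟩ := exists_coord_eq (r := r)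
          (y := fun i => (if i = k then (r + 1 : ℂ) else 0) - 1) (by simp)
        exact ⟨x, fun i => congrFun hx i⟩
      obtain ⟨x, hx⟩ := hex i
      obtain ⟨y, hy⟩ := hex j
      have hn : (r + 1 : ℂ) ≠ 0 := by exact_mod_cast Nat.succ_ne_zero r
      have := hminor i j x y
      simp [hs, hx, hy, hi, hj, hji, hji.symm, hjs.symm] at this
      exact hn (by linear_combination -this)
  · obtain ⟨k, l, m, h1, h2, h3, h4, h5, h6⟩ := exists_disjoint_of_sign_eq_neg_one hr hs
    -- On `e_k - e_m` and `e_l - e_m` the minor of `-σ - 1` in rows `k`, `l` is triangular, with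
    -- diagonal entries `-1` or `-2`.
    have hex : ∀ k m : Fin (r + 1), ∃ x, ∀ i, coord r x i =
        (if i = k then (1 : ℂ) else 0) - if i = m then 1 else 0 := by
      intro k m
      obtain ⟨x, hx⟩ := exists_coord_eq (r := r)
        (y := fun i => (if i = k then (1 : ℂ) else 0) - if i = m then 1 else 0) (by simp)
      exact ⟨x, fun i => congrFun hx i⟩
    obtain ⟨x, hx⟩ := hex k m
    obtain ⟨y, hy⟩ := hex l m
    have hne : ∀ p : Prop, [Decidable p] → -(if p then (1 : ℂ) else 0) - 1 ≠ 0 := by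
      intro p _
      split_ifs <;> norm_num
    have := hminor k l x y
    simp only [hs, hx, hy, h1.symm, h2.symm, h3.symm, h4.symm, h5.symm, h6.symm, if_true, if_false,
      Units.val_neg, Units.val_one, Int.cast_neg, Int.cast_one, sub_zero, neg_mul, one_mul,
      mul_zero, zero_mul, mul_eq_zero, hne, or_self] at this

theorem newRep_not_isReflectionRep (hr : 2 < r) : ¬ IsReflectionRep (newRep cs) := by
  intro h
  have hempty : {g | g ∈ (newRep cs).asGroupHom.range ∧ IsReflection g} = ∅ := by
    refine Set.eq_empty_of_forall_notMem ?_
    rintro _ ⟨⟨w, rfl⟩, -, hw⟩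
    rw [Representation.asGroupHom_apply] at hw
    exact finrank_range_newRep_sub_one_ne_one cs hr w hw
  rw [IsReflectionRep, hempty, Subgroup.closure_empty] at h
  let s : Fin r := ⟨0, by omega⟩
  have h1 : (newRep cs).asGroupHom (cs.simple s) = 1 := by
    rw [← Subgroup.mem_bot, h]
    exact ⟨_, rfl⟩
  have h2 : newRep cs (cs.simple s) = 1 := by
    rw [← Representation.asGroupHom_apply, h1, Units.val_one]
  have hne : s.castSucc ≠ s.succ := Fin.castSucc_lt_succ.ne
  obtain ⟨m, hm⟩ := exists_notMem_of_card_le {s.castSucc, s.succ} Finset.card_le_two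
    (show 2 < r + 1 by omega)
  simp only [Finset.mem_insert, Finset.mem_singleton, not_or] at hm
  -- For `e_s - e_m` with `m` outside the swapped pair, a trivial action of `s` would give `1 = 0`
  -- in coordinate `s.castSucc`.
  obtain ⟨x, hx⟩ := exists_coord_eq (r := r)
    (y := fun i => (if i = s.castSucc then (1 : ℂ) else 0) - if i = m then 1 else 0) (by simp)
  have h3 := coord_newRep_simple cs s x s.castSucc
  rw [h2, Module.End.one_apply, hx] at h3
  simp [hne.symm, Ne.symm hm.1, Ne.symm hm.2] at h3

end Reflections

/-! ### Two coprime semi-invariants of the sign character -/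

section Invariants

variable {r : ℕ} {W : Type*} [Group W] (cs : CoxeterSystem (CoxeterMatrix.A r) W)

/-- The coordinate `y_i` as a linear form. -/
def coordForm (i : Fin (r + 1)) : Module.Dual ℂ (ℂ ⊗[ℂ] (Fin r → ℂ)) :=
  LinearMap.proj i ∘ₗ coord r

@[simp]
theorem coordForm_apply (i : Fin (r + 1)) (x : ℂ ⊗[ℂ] (Fin r → ℂ)) :
    coordForm i x = coord r x i := rfl

/-- The linear forms `y_j - y_i` and `y_j + y_i`. -/
def pairForm (p : (_ : Fin (r + 1)) × Fin (r + 1)) (plus : Bool) :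
    Module.Dual ℂ (ℂ ⊗[ℂ] (Fin r → ℂ)) :=
  if plus then coordForm p.2 + coordForm p.1 else coordForm p.2 - coordForm p.1

theorem pairForm_ne_zero (hr : 2 < r) {p : (_ : Fin (r + 1)) × Fin (r + 1)} (hp : p.1 ≠ p.2)
    (plus : Bool) : pairForm p plus ≠ 0 := by
  intro h0
  obtain ⟨m, hm⟩ := exists_notMem_of_card_le {p.1, p.2} Finset.card_le_two
    (show 2 < r + 1 by omega)
  simp only [Finset.mem_insert, Finset.mem_singleton, not_or] at hm
  obtain ⟨x, hx⟩ := exists_coord_eq (r := r)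
    (y := fun i => (if i = p.1 then (1 : ℂ) else 0) - if i = m then 1 else 0) (by simp)
  have := LinearMap.congr_fun h0 x
  cases plus <;> simp [pairForm, hx, hp.symm, Ne.symm hm.1, Ne.symm hm.2] at this

/-- The third power sum of the coordinates. -/
def cubeSum (x : ℂ ⊗[ℂ] (Fin r → ℂ)) : ℂ := ∑ i, coord r x i ^ 3

theorem cubeSum_mem_polyFun : cubeSum (r := r) ∈ polyFun (ℂ ⊗[ℂ] (Fin r → ℂ)) := by
  have h : cubeSum (r := r) = ∑ i, (coordForm i : ℂ ⊗[ℂ] (Fin r → ℂ) → ℂ) ^ 3 := by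
    ext x
    simp [cubeSum]
  rw [h]
  exact sum_mem fun i _ => pow_mem (dual_mem_polyFun _) 3

theorem signRep_apply_one_sq (w : W) : signRep cs w 1 ^ 2 = 1 := by
  obtain ⟨σ, h, -⟩ := exists_perm_coord_newRep cs w
  rw [h]
  rcases Int.units_eq_one_or (Equiv.Perm.sign σ) with hs | hs <;> simp [hs]

/-- Power sums are symmetric, and the degree 3 is odd, so the twist contributes `sign ^ 3 = sign`.
-/
theorem cubeSum_newRep (w : W) (x : ℂ ⊗[ℂ] (Fin r → ℂ)) :
    cubeSum (newRep cs w x) = signRep cs w 1 * cubeSum x := by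
  obtain ⟨σ, h, hσ⟩ := exists_perm_coord_newRep cs w
  have hsum : ∑ i, coord r x (σ i) ^ 3 = ∑ i, coord r x i ^ 3 :=
    Equiv.sum_comp σ fun i => coord r x i ^ 3
  simp only [cubeSum, hσ, h, mul_pow, ← Finset.mul_sum, hsum]
  rcases Int.units_eq_one_or (Equiv.Perm.sign σ) with hs | hs
  · simp [hs]
  · norm_num [hs]

theorem exists_pairForm_false_eq_zero (hr : 2 < r) {p : (_ : Fin (r + 1)) × Fin (r + 1)}
    (hp : p.1 ≠ p.2) : ∃ x, pairForm p false x = 0 ∧ cubeSum x ≠ 0 := by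
  obtain ⟨i, j⟩ := p
  simp only at hp
  obtain ⟨m, hm⟩ := exists_notMem_of_card_le {i, j} Finset.card_le_two
    (show 2 < r + 1 by omega)
  simp only [Finset.mem_insert, Finset.mem_singleton, not_or] at hm
  obtain ⟨hmi, hmj⟩ := hm
  -- The vector `e_i + e_j - 2 e_m` has cube sum `1 + 1 - 8 = -6`.
  obtain ⟨x, hx⟩ := exists_coord_eq (r := r) (y := fun t => (if t = i then (1 : ℂ) else 0) +
    (if t = j then 1 else 0) + (if t = m then -2 else 0))
    (by simp [Finset.sum_add_distrib]; norm_num)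
  have hcube : ∀ t, coord r x t ^ 3 = (if t = i then (1 : ℂ) else 0) +
      (if t = j then 1 else 0) + (if t = m then -8 else 0) := by
    intro t
    rw [hx]
    by_cases h1 : t = i
    · subst h1; simp [hp, Ne.symm hmi]
    by_cases h2 : t = j
    · subst h2; simp [hp.symm, Ne.symm hmj]
    by_cases h3 : t = m
    · subst h3; simp [hmi, hmj]; norm_num
    simp [h1, h2, h3]
  refine ⟨x, ?_, ?_⟩
  · simp [pairForm, hx, hp, hp.symm, Ne.symm hmi, Ne.symm hmj]
  · simp only [cubeSum, hcube, Finset.sum_add_distrib]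
    simp
    norm_num

/-- Five coordinates are needed: with four, `y_i + y_j = 0` forces the other two to be opposite, so
the cube sum vanishes. Here `(1, -1, 2, -1, -1)` has cube sum `6`. -/
theorem exists_pairForm_true_eq_zero (hr : 3 < r) {p : (_ : Fin (r + 1)) × Fin (r + 1)}
    (hp : p.1 ≠ p.2) : ∃ x, pairForm p true x = 0 ∧ cubeSum x ≠ 0 := by
  obtain ⟨i, j⟩ := p
  simp only at hp
  obtain ⟨m, hm⟩ := exists_notMem_of_card_le {i, j} Finset.card_le_two
    (show 2 < r + 1 by omega)
  obtain ⟨k, hk⟩ := exists_notMem_of_card_le {i, j, m} Finset.card_le_three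
    (show 3 < r + 1 by omega)
  obtain ⟨l, hl⟩ := exists_notMem_of_card_le {i, j, m, k} Finset.card_le_four
    (show 4 < r + 1 by omega)
  simp only [Finset.mem_insert, Finset.mem_singleton, not_or] at hm hk hl
  obtain ⟨hmi, hmj⟩ := hm
  obtain ⟨hki, hkj, hkm⟩ := hk
  obtain ⟨hli, hlj, hlm, hlk⟩ := hl
  obtain ⟨x, hx⟩ := exists_coord_eq (r := r) (y := fun t => (if t = i then (1 : ℂ) else 0) +
    (if t = j then -1 else 0) + (if t = m then 2 else 0) + (if t = k then -1 else 0) +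
    (if t = l then -1 else 0)) (by simp [Finset.sum_add_distrib]; norm_num)
  have hcube : ∀ t, coord r x t ^ 3 = (if t = i then (1 : ℂ) else 0) +
      (if t = j then -1 else 0) + (if t = m then 8 else 0) + (if t = k then -1 else 0) +
      (if t = l then -1 else 0) := by
    intro t
    rw [hx]
    by_cases h1 : t = i
    · subst h1; simp [hp, Ne.symm hmi, Ne.symm hki, Ne.symm hli]
    by_cases h2 : t = j
    · subst h2; simp [hp.symm, Ne.symm hmj, Ne.symm hkj, Ne.symm hlj]; norm_num
    by_cases h3 : t = m
    · subst h3; simp [hmi, hmj, Ne.symm hkm, Ne.symm hlm]; norm_num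
    by_cases h4 : t = k
    · subst h4; simp [hki, hkj, hkm, Ne.symm hlk]; norm_num
    by_cases h5 : t = l
    · subst h5; simp [hli, hlj, hlm, hlk]; norm_num
    simp [h1, h2, h3, h4, h5]
  refine ⟨x, ?_, ?_⟩
  · simp [pairForm, hx, hp, hp.symm, Ne.symm hmi, Ne.symm hmj, Ne.symm hki, Ne.symm hkj,
      Ne.symm hli, Ne.symm hlj]
  · simp only [cubeSum, hcube, Finset.sum_add_distrib]
    simp
    norm_num

/-- The Vandermonde determinant in the `q (y_i)` is a semi-invariant of the sign character, if it is
an even function. -/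
theorem det_vandermonde_newRep (q : ℂ → ℂ)
    (hq : ∀ y : Fin (r + 1) → ℂ, (Matrix.vandermonde fun i => q (-y i)).det =
      (Matrix.vandermonde fun i => q (y i)).det) (w : W) (x : ℂ ⊗[ℂ] (Fin r → ℂ)) :
    (Matrix.vandermonde fun i => q (coord r (newRep cs w x) i)).det =
      signRep cs w 1 * (Matrix.vandermonde fun i => q (coord r x i)).det := by
  obtain ⟨σ, h, hσ⟩ := exists_perm_coord_newRep cs w
  have hperm := Matrix.det_permute σ (Matrix.vandermonde fun i => q (coord r x i))
  have hsub : (Matrix.vandermonde fun i => q (coord r x i)).submatrix σ id =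
      Matrix.vandermonde fun i => q (coord r x (σ i)) := rfl
  rw [hsub] at hperm
  rw [h, ← hperm]
  rcases Int.units_eq_one_or (Equiv.Perm.sign σ) with hs | hs
  · simp [hσ, hs]
  · rw [← hq]
    simp [hσ, hs]

/-- Treats two choices of `f` at once: the Vandermonde product in the `y_i`, or in the `y_i²`, whose
factors split as `(y_j - y_i)(y_j + y_i)`. -/
theorem not_isPolynomialRing_of_pairForms (hr : 2 < r) (T : Finset Bool) (q : ℂ → ℂ)
    (hq : ∀ y : Fin (r + 1) → ℂ, (Matrix.vandermonde fun i => q (-y i)).det =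
      (Matrix.vandermonde fun i => q (y i)).det)
    (hT : ∀ p x, ∏ b ∈ T, pairForm (r := r) p b x = q (coord r x p.2) - q (coord r x p.1))
    (hT' : ∀ b ∈ T, ∀ p : (_ : Fin (r + 1)) × Fin (r + 1), p.1 ≠ p.2 →
      ∃ x, pairForm p b x = 0 ∧ cubeSum x ≠ 0) :
    ¬ IsPolynomialRing (invariantRing (newRep cs)) := by
  let s := (Finset.univ : Finset (Fin (r + 1))).sigma fun i => Finset.Ioi i
  have hs : ∀ p ∈ s, p.1 ≠ p.2 := fun p hp => by
    simp only [s, Finset.mem_sigma, Finset.mem_Ioi] at hp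
    exact hp.2.ne
  have hprod : ∀ x, ∏ p ∈ s ×ˢ T, pairForm (r := r) p.1 p.2 x =
      (Matrix.vandermonde fun i => q (coord r x i)).det := by
    intro x
    rw [Finset.prod_product, Matrix.det_vandermonde, Finset.prod_sigma]
    simp only [hT]
  refine not_isPolynomialRing_of_semiinvariants (newRep cs) (fun w => signRep cs w 1)
    (signRep_apply_one_sq cs) (g₀ := cs.simple ⟨0, by omega⟩) ?_ (s ×ˢ T)
    (fun p => pairForm p.1 p.2) ?_ ?_ cubeSum_mem_polyFun (cubeSum_newRep cs) ?_
  · rw [signRep_simple]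
    norm_num [LinearMap.neg_apply]
  · exact fun p hp => pairForm_ne_zero hr (hs _ (Finset.mem_product.mp hp).1) _
  · intro w x
    rw [hprod, hprod, det_vandermonde_newRep cs q hq]
  · exact fun p hp => hT' _ (Finset.mem_product.mp hp).2 _ (hs _ (Finset.mem_product.mp hp).1)

theorem newRep_not_isPolynomialRing (hr : 2 < r) :
    ¬ IsPolynomialRing (invariantRing (newRep cs)) := by
  obtain rfl | hr' : r = 3 ∨ 3 < r := by omega
  -- For `r = 3` the forms `y_j + y_i` divide the cube sum, so only differences are allowed; the
  -- Vandermonde product has even degree `3 + 2 + 1 = 6` and so is an even function.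
  · refine not_isPolynomialRing_of_pairForms cs hr {false} id ?_ ?_ ?_
    · intro y
      simp only [Matrix.det_vandermonde, id]
      have h : ∀ i : Fin 4, ∏ j ∈ Finset.Ioi i, (-y j - -y i) =
          (-1) ^ (Finset.Ioi i).card * ∏ j ∈ Finset.Ioi i, (y j - y i) := by
        intro i
        rw [← Finset.prod_const, ← Finset.prod_mul_distrib]
        exact Finset.prod_congr rfl fun j _ => by ring
      simp only [h, Finset.prod_mul_distrib, Fin.card_Ioi]
      simp [Fin.prod_univ_four]
      ring
    · intro p x
      simp [pairForm]
    · intro b hb p hp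
      rw [Finset.mem_singleton] at hb
      subst hb
      exact exists_pairForm_false_eq_zero hr hp
  -- Squaring the variables makes the Vandermonde product even whatever the parity of `r(r+1)/2`.
  · refine not_isPolynomialRing_of_pairForms cs hr Finset.univ (fun z => z ^ 2) ?_ ?_ ?_
    · simp
    · intro p x
      simp [pairForm]
      ring
    · intro b _ p hp
      cases b
      · exact exists_pairForm_false_eq_zero hr hp
      · exact exists_pairForm_true_eq_zero hr' hp

end Invariants

end CoxeterRep

end

theorem mainTheorem4 {r : ℕ} (hr : 2 < r) {W : Type*} [Group W]
    (cs : CoxeterSystem (CoxeterMatrix.A r) W) :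
    (CoxeterRep.newRep cs).IsIrreducible ∧
      ¬ CoxeterRep.IsReflectionRep (CoxeterRep.newRep cs) ∧
      ¬ CoxeterRep.IsPolynomialRing (CoxeterRep.invariantRing (CoxeterRep.newRep cs)) :=
  ⟨CoxeterRep.newRep_isIrreducible cs (by omega), CoxeterRep.newRep_not_isReflectionRep cs hr,
    CoxeterRep.newRep_not_isPolynomialRing cs hr⟩
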